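/- Let $R$ be an associative ring with identity; modules are unital right $R$-modules. For modules $M,N$, say that $M$ is $N$-injective if every morphism $K\to M$ from a submodule $K\le N$ extends to $N$; the injectivity domain of $M$ is the class $\mathfrak{In}^{-1}(M)$ of all $N$ such that $M$ is $N$-injective. The right $i$-profile $i\mathcal P(R)$ is the collection of all classes $\mathfrak{In}^{-1}(M)$, ordered by inclusion. A Wisbauer class (hereditary pretorsion class) is a class of modules closed under homomorphic images, submodules and arbitrary direct sums; these classes, ordered by inclusion, form the lattice $\mathrm{Wis}\text{-}R$. A linear filter is a set $\mathfrak F$ of right ideals that contains $R$, is closed under finite intersections and under passing to larger right ideals, and contains $(I:r)=\{s\in R: rs\in I\}$ for all $I\in\mathfrak F$, $r\in R$; linear filters are ordered by inclusion. A left exact preradical is a subfunctor $\tau$ of the identity functor of $\mathrm{Mod}\text{-}R$ such that $\tau(K)=\tau(N)\cap K$ whenever $K\le N$; these are ordered pointwise. A main injective module is an injective module $E$ such that $\tau(N)=\bigcap_{f\in\mathrm{Hom}(N,E)}f^{-1}(\tau(E))$ for every left exact preradical $\tau$ and every module $N$. Theorem. Every Wisbauer class $\mathcal W$ that contains all semisimple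 modules is the injectivity domain of some module. In other words, $i\mathcal P(R)$ equals the interval $[\mathrm{SSMod}\text{-}R,\mathrm{Mod}\text{-}R]$ of $\mathrm{Wis}\text{-}R$, where $\mathrm{SSMod}\text{-}R$ is the class of semisimple modules. Consequently, $i\mathcal P(R)$ is isomorphic, as a lattice, to each of the following: 1. the lattice of linear filters of right ideals of $R$ that contain every maximal right ideal; 2. the lattice of left exact preradicals $\tau$ with $\mathrm{Soc}(N)\subseteq\tau(N)$ for every module $N$; 3. for any main injective module $E$, the lattice of fully invariant submodules $A$ of $E$ with $\mathrm{Soc}(E)\subseteq A$. Moreover, main injective modules exist over every ring. -/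

import Mathlib

open scoped DirectSum MulOpposite

universe u

/-- The category of (unital) right `R`-modules, i.e. of modules over the opposite ring. -/
abbrev RightMod (R : Type u) [Ring R] := ModuleCat.{u} Rᵐᵒᵖ

/-- Right ideals of `R`: submodules of `R` as a right module over itself
(`MulOpposite.op r • x = x * r`). -/
abbrev RightIdeal (R : Type u) [Ring R] := Submodule Rᵐᵒᵖ R

section Modules

variable {R : Type u} [Ring R]

/-- `M` is `N`-injective: every morphism from a submodule of `N` to `M` extends to `N`. -/
def IsInjectiveRelativeTo (M N : RightMod R) : Prop :=
  ∀ (K : Submodule Rᵐᵒᵖ N) (φ : K →ₗ[Rᵐᵒᵖ] M),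
    ∃ ψ : N →ₗ[Rᵐᵒᵖ] M, ∀ x : K, ψ x = φ x

/-- The injectivity domain of `M`. -/
def injectivityDomain (M : RightMod R) : Set (RightMod R) :=
  {N | IsInjectiveRelativeTo M N}

/-- The socle of a module: the sum of its simple submodules. -/
def moduleSocle (M : RightMod R) : Submodule Rᵐᵒᵖ M :=
  sSup {S : Submodule Rᵐᵒᵖ M | IsSimpleModule Rᵐᵒᵖ S}

/-- The right ideal `(I : r) = {s | r * s ∈ I}`. -/
def RightIdeal.residual (I : RightIdeal R) (r : R) : RightIdeal R where
  carrier := {s | r * s ∈ I}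
  add_mem' := by
    intro a b ha hb
    simpa [mul_add] using I.add_mem ha hb
  zero_mem' := by simp
  smul_mem' := by
    intro c x hx
    simpa [mul_assoc] using I.smul_mem c hx

end Modules

/-- The right injective profile: the classes of right modules of the form `injectivityDomain M`
(the `i`-portfolios), ordered by inclusion. -/
def iProfile (R : Type u) [Ring R] : Set (Set (RightMod R)) :=
  {A | ∃ M : RightMod R, A = injectivityDomain M}

/-- Wisbauer classes (hereditary pretorsion classes) of right modules: classes closed under
homomorphic images (in particular under isomorphism), submodules and arbitrary direct sums. -/
@[ext]
structure WisbauerClass (R : Type u) [Ring R] where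
  carrier : Set (RightMod R)
  image_mem : ∀ (M N : RightMod R) (f : M →ₗ[Rᵐᵒᵖ] N),
    Function.Surjective f → M ∈ carrier → N ∈ carrier
  submodule_mem : ∀ (M : RightMod R) (K : Submodule Rᵐᵒᵖ M),
    M ∈ carrier → ModuleCat.of Rᵐᵒᵖ K ∈ carrier
  directSum_mem : ∀ (ι : Type u) (N : ι → RightMod R),
    (∀ i, N i ∈ carrier) → ModuleCat.of Rᵐᵒᵖ (⨁ i, N i) ∈ carrier

/-- Linear filters of right ideals. -/
@[ext]
structure LinearFilter (R : Type u) [Ring R] where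
  carrier : Set (RightIdeal R)
  top_mem : ⊤ ∈ carrier
  inf_mem : ∀ I J : RightIdeal R, I ∈ carrier → J ∈ carrier → I ⊓ J ∈ carrier
  mem_of_le : ∀ I J : RightIdeal R, I ∈ carrier → I ≤ J → J ∈ carrier
  residual_mem : ∀ (I : RightIdeal R) (r : R), I ∈ carrier → I.residual r ∈ carrier

/-- Left exact preradicals of right modules: subfunctors `τ` of the identity functor such that
`τ(K) = τ(M) ∩ K` for all submodules `K ≤ M`. -/
@[ext]
structure LeftExactPreradical (R : Type u) [Ring R] where
  toFun : ∀ M : RightMod R, Submodule Rᵐᵒᵖ M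
  map_le : ∀ (M N : RightMod R) (f : M →ₗ[Rᵐᵒᵖ] N), (toFun M).map f ≤ toFun N
  submodule_eq : ∀ (M : RightMod R) (K : Submodule Rᵐᵒᵖ M),
    toFun (ModuleCat.of Rᵐᵒᵖ K) = (toFun M).comap K.subtype

section Lattices

variable {R : Type u} [Ring R]

/-- Wisbauer classes are ordered by inclusion. -/
instance : PartialOrder (WisbauerClass R) :=
  PartialOrder.lift WisbauerClass.carrier fun _ _ => WisbauerClass.ext

/-- Linear filters are ordered by inclusion. -/
instance : PartialOrder (LinearFilter R) :=
  PartialOrder.lift LinearFilter.carrier fun _ _ => LinearFilter.ext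

/-- Left exact preradicals are ordered pointwise. -/
instance : PartialOrder (LeftExactPreradical R) :=
  PartialOrder.lift LeftExactPreradical.toFun fun _ _ => LeftExactPreradical.ext

/-- Infima of Wisbauer classes are intersections. -/
instance : InfSet (WisbauerClass R) where
  sInf S :=
    { carrier := {M | ∀ W ∈ S, M ∈ W.carrier}
      image_mem := fun M N f hf hM W hW => W.image_mem M N f hf (hM W hW)
      submodule_mem := fun M K hM W hW => W.submodule_mem M K (hM W hW)
      directSum_mem := fun ι N hN W hW => W.directSum_mem ι N fun i => hN i W hW }

/-- Infima of linear filters are intersections. -/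
instance : InfSet (LinearFilter R) where
  sInf S :=
    { carrier := {I | ∀ F ∈ S, I ∈ F.carrier}
      top_mem := fun F _ => F.top_mem
      inf_mem := fun I J hI hJ F hF => F.inf_mem I J (hI F hF) (hJ F hF)
      mem_of_le := fun I J hI hIJ F hF => F.mem_of_le I J (hI F hF) hIJ
      residual_mem := fun I r hI F hF => F.residual_mem I r (hI F hF) }

/-- Infima of left exact preradicals are pointwise intersections. -/
instance : InfSet (LeftExactPreradical R) where
  sInf S :=
    { toFun := fun M => ⨅ τ ∈ S, τ.toFun M
      map_le := fun M N f => by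
        rw [Submodule.map_le_iff_le_comap]
        intro x hx
        simp only [Submodule.mem_comap, Submodule.mem_iInf] at hx ⊢
        exact fun τ hτ => τ.map_le M N f ⟨x, hx τ hτ, rfl⟩
      submodule_eq := fun M K => by
        ext x
        simp only [Submodule.mem_comap, Submodule.mem_iInf]
        refine forall₂_congr fun τ _ => ?_
        rw [τ.submodule_eq M K]
        rfl }

/-- The lattice of Wisbauer classes. -/
instance : CompleteLattice (WisbauerClass R) :=
  completeLatticeOfInf _ fun _ =>
    ⟨fun W hW _ hM => hM W hW, fun _ hV _ hM _ hW => hV hW hM⟩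

/-- The lattice of linear filters of right ideals. -/
instance : CompleteLattice (LinearFilter R) :=
  completeLatticeOfInf _ fun _ =>
    ⟨fun F hF _ hI => hI F hF, fun _ hG _ hI _ hF => hG hF hI⟩

/-- The lattice of left exact preradicals. -/
instance : CompleteLattice (LeftExactPreradical R) :=
  completeLatticeOfInf _ fun _ =>
    ⟨fun τ hτ _ => iInf₂_le τ hτ, fun _ hσ M => le_iInf₂ fun _ hτ => hσ hτ M⟩

end Lattices

/-- The Wisbauer class of semisimple modules. -/
def ssMod (R : Type u) [Ring R] : WisbauerClass R where
  carrier := {M | IsSemisimpleModule Rᵐᵒᵖ M}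
  image_mem := fun _ _ f hf (_ : IsSemisimpleModule _ _) => IsSemisimpleModule.of_surjective f hf
  submodule_mem := fun _ K (_ : IsSemisimpleModule _ _) =>
    inferInstanceAs (IsSemisimpleModule Rᵐᵒᵖ K)
  directSum_mem := fun _ N (_ : ∀ i, IsSemisimpleModule Rᵐᵒᵖ (N i)) =>
    inferInstanceAs (IsSemisimpleModule Rᵐᵒᵖ (Π₀ i, N i))

/-- `E` is a main injective module: it is injective and every left exact preradical `τ` satisfies
`τ(N) = ⋂ {f⁻¹(τ(E)) : f ∈ Hom(N, E)}` for all modules `N`. -/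
def IsMainInjective {R : Type u} [Ring R] (E : RightMod R) : Prop :=
  Module.Injective Rᵐᵒᵖ E ∧
    ∀ (τ : LeftExactPreradical R) (N : RightMod R),
      τ.toFun N = ⨅ f : N →ₗ[Rᵐᵒᵖ] E, (τ.toFun E).comap f

/-!
The classes in question are all determined by right ideals. If `rightAnn R x` denotes the
annihilator of an element `x` of a right module, then `x` generates a copy of `R ⧸ rightAnn R x`,
so that a linear filter `F` amounts both to the left exact preradical sending a module `N` to its
torsion submodule `F.torsion N = {x | rightAnn R x ∈ F}` and to the Wisbauer class of the torsion
modules, those with `F.torsion N = ⊤` (`linearFilterEquivPreradical`,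
`wisbauerClassEquivLinearFilter`). Under these correspondences the class contains the semisimple
modules iff the filter contains the maximal right ideals iff the preradical contains the socle.

Every injectivity domain is a Wisbauer class containing the semisimple modules. The delicate
closure property, that under direct sums, is a Zorn's lemma argument as in Baer's criterion
(`ExtendsFromSubmodules.of_iSup_eq_top`). For the converse, let `F` contain the maximal right
ideals and let `N` not be torsion. Some module `M` is injective relative to all torsion modules but
not relative to `N` (`exists_separating_module`):

* if `N` has a submodule `K ≠ 0` without torsion, then `K` has no simple submodule, hence is not
  semisimple, and `M` can be any submodule of `K` that is not a direct summand of `K`; no torsion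
  module has a nonzero map to `M`;
* otherwise the torsion submodule of `N` is essential, and `M` can be the torsion submodule of an
  injective module `E` containing `N`, since an extension to `N` of the inclusion
  `F.torsion N → F.torsion E` would embed `N` in a torsion module.

Up to isomorphism there is only a set of cyclic modules `R ⧸ I`. The product of modules `M`
separating those that are not torsion has exactly the torsion modules in its injectivity domain
(`exists_injectivityDomain_eq`).

Any injective module containing all `R ⧸ I` is a main injective module
(`isMainInjective_of_cyclic`). For a main injective module `E`, the defining formula shows that
`τ ↦ τ(E)` is an order embedding of the left exact preradicals; a fully invariant submodule `A` of
`E` is the value at `E` of `N ↦ ⋂ {f⁻¹(A) : f ∈ Hom(N, E)}` (`preradicalEquivFullyInvariant`).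
-/

/-! ### Relative injectivity -/

section RelativeInjectivity

variable {S : Type*} [Ring S]

/-- Every `S`-linear map from a submodule of `N` to `M` extends to `N`; this is
`IsInjectiveRelativeTo` for unbundled modules. -/
def ExtendsFromSubmodules (S M N : Type*) [Ring S] [AddCommGroup M] [Module S M]
    [AddCommGroup N] [Module S N] : Prop :=
  ∀ (K : Submodule S N) (φ : K →ₗ[S] M), ∃ ψ : N →ₗ[S] M, ∀ x : K, ψ x = φ x

namespace ExtendsFromSubmodules

variable {M N P : Type*} [AddCommGroup M] [Module S M] [AddCommGroup N] [Module S N]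
  [AddCommGroup P] [Module S P]

theorem extend_of_injective (h : ExtendsFromSubmodules S M N) (i : P →ₗ[S] N)
    (hi : Function.Injective i) (φ : P →ₗ[S] M) : ∃ ψ : N →ₗ[S] M, ∀ x, ψ (i x) = φ x := by
  let e := LinearEquiv.ofInjective i hi
  obtain ⟨ψ, hψ⟩ := h (LinearMap.range i) (φ ∘ₗ e.symm.toLinearMap)
  refine ⟨ψ, fun x => ?_⟩
  have := hψ (e x)
  simpa [e] using this

theorem of_injective (h : ExtendsFromSubmodules S M N) (i : P →ₗ[S] N)
    (hi : Function.Injective i) : ExtendsFromSubmodules S M P := by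
  intro K φ
  obtain ⟨ψ, hψ⟩ := h.extend_of_injective (i ∘ₗ K.subtype)
    (hi.comp K.injective_subtype) φ
  exact ⟨ψ ∘ₗ i, hψ⟩

theorem of_surjective (h : ExtendsFromSubmodules S M N) (f : N →ₗ[S] P)
    (hf : Function.Surjective f) : ExtendsFromSubmodules S M P := by
  intro K φ
  obtain ⟨ψ, hψ⟩ := h (K.comap f) (φ ∘ₗ f.restrict fun _ hx => hx)
  have hker : LinearMap.ker f ≤ LinearMap.ker ψ := by
    intro x hx
    rw [LinearMap.mem_ker] at hx ⊢
    have hxK : x ∈ K.comap f := by simp [hx]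
    have h0 : f.restrict (fun _ hx => hx) (⟨x, hxK⟩ : K.comap f) = (0 : K) := Subtype.ext hx
    rw [show ψ x = _ from hψ ⟨x, hxK⟩, LinearMap.comp_apply, h0, map_zero]
  let e := f.quotKerEquivOfSurjective hf
  refine ⟨(LinearMap.ker f).liftQ ψ hker ∘ₗ e.symm.toLinearMap, ?_⟩
  rintro ⟨y, hy⟩
  obtain ⟨x, rfl⟩ := hf y
  have he : e.symm (f x) = (LinearMap.ker f).mkQ x := by
    rw [LinearEquiv.symm_apply_eq]
    rfl
  simp only [LinearMap.comp_apply, LinearEquiv.coe_coe, he, Submodule.mkQ_apply,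
    Submodule.liftQ_apply]
  exact hψ ⟨x, hy⟩

/-- If `N` is a sum of submodules `T i` from whose submodules maps to `M` extend, then the same
holds for `N`: the domain of a maximal extension has to contain each `T i`, since an extension of
its restriction to `domain ⊓ T i` can be glued to it. -/
theorem of_iSup_eq_top {ι : Type*} (T : ι → Submodule S N) (hT : ⨆ i, T i = ⊤)
    (h : ∀ i, ExtendsFromSubmodules S M (T i)) : ExtendsFromSubmodules S M N := by
  intro K φ
  have : Fact (Function.Injective K.subtype) := ⟨K.injective_subtype⟩
  let g := Module.Baer.extensionOfMax K.subtype φ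
  have hle : ∀ i, T i ≤ g.domain := by
    intro i
    obtain ⟨ψ, hψ⟩ := h i (g.domain.comap (T i).subtype)
      (g.toFun ∘ₗ (T i).subtype.restrict fun _ hx => hx)
    let p : N →ₗ.[S] M := ⟨T i, ψ⟩
    have hp : ∀ (x : g.domain) (y : p.domain), (x : N) = y → g.toLinearPMap x = p y := by
      rintro ⟨x, hx⟩ ⟨y, hy⟩ (rfl : x = y)
      exact (hψ ⟨⟨x, hy⟩, hx⟩).symm
    let g' : Module.Baer.ExtensionOf K.subtype φ :=
      { g.toLinearPMap.sup p hp with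
        le := g.le.trans (g.toLinearPMap.left_le_sup p hp).1
        is_extension := fun m =>
          (g.is_extension m).trans ((g.toLinearPMap.left_le_sup p hp).2 rfl) }
    have hg' : g' = g := Module.Baer.extensionOfMax_is_max K.subtype φ g'
      (g.toLinearPMap.left_le_sup p hp)
    rw [← hg']
    exact (g.toLinearPMap.right_le_sup p hp).1
  have htop : ∀ x, x ∈ g.domain := fun x =>
    (hT.ge.trans (iSup_le hle)) (Submodule.mem_top : x ∈ ⊤)
  exact ⟨g.toFun ∘ₗ LinearMap.id.codRestrict g.domain htop, fun x => (g.is_extension x).symm⟩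

/-- Injectivity domains are closed under direct sums of any size. -/
theorem directSum {ι : Type*} (N : ι → Type*) [∀ i, AddCommGroup (N i)] [∀ i, Module S (N i)]
    (h : ∀ i, ExtendsFromSubmodules S M (N i)) : ExtendsFromSubmodules S M (⨁ i, N i) := by
  classical
  refine of_iSup_eq_top (fun i => LinearMap.range (DirectSum.lof S ι N i))
    DFinsupp.iSup_range_lsingle fun i => ?_
  exact (h i).of_surjective (DirectSum.lof S ι N i).rangeRestrict
    (LinearMap.surjective_rangeRestrict _)

theorem of_isSemisimpleModule [IsSemisimpleModule S N] : ExtendsFromSubmodules S M N :=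
  fun _ φ => (IsSemisimpleModule.extension_property _ (Submodule.injective_subtype _) φ).imp
    fun _ h x => LinearMap.congr_fun h x

theorem pi_iff {ι : Type*} (M : ι → Type*) [∀ i, AddCommGroup (M i)] [∀ i, Module S (M i)] :
    ExtendsFromSubmodules S (∀ i, M i) N ↔ ∀ i, ExtendsFromSubmodules S (M i) N := by
  classical
  refine ⟨fun h i K φ => ?_, fun h K φ => ?_⟩
  · obtain ⟨ψ, hψ⟩ := h K (LinearMap.single S M i ∘ₗ φ)
    exact ⟨LinearMap.proj i ∘ₗ ψ, fun x => by simp [hψ]⟩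
  · choose ψ hψ using fun i => h i K (LinearMap.proj i ∘ₗ φ)
    exact ⟨LinearMap.pi ψ, fun x => funext fun i => hψ i x⟩

/-- A module `N` all of whose submodules `K` are `N`-injective is semisimple: the identity of `K`
extends to a projection of `N` onto `K`. -/
theorem isSemisimpleModule_of_submodules
    (h : ∀ K : Submodule S N, ExtendsFromSubmodules S K N) : IsSemisimpleModule S N where
  exists_isCompl K := by
    obtain ⟨p, hp⟩ := h K K LinearMap.id
    exact ⟨_, LinearMap.isCompl_of_proj hp⟩

end ExtendsFromSubmodules

end RelativeInjectivity

/-! ### Annihilators of elements -/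

section Annihilators

variable {R : Type u} [Ring R]

/-- The map `r ↦ x r` from `R` to a right module. -/
def orbitMap (R : Type u) [Ring R] {N : Type*} [AddCommGroup N] [Module Rᵐᵒᵖ N] (x : N) :
    R →ₗ[Rᵐᵒᵖ] N where
  toFun r := MulOpposite.op r • x
  map_add' r s := by rw [MulOpposite.op_add, add_smul]
  map_smul' c r := by simp [mul_smul]

/-- The annihilator `{r | x r = 0}` of an element of a right module, a right ideal. -/
def rightAnn (R : Type u) [Ring R] {N : Type*} [AddCommGroup N] [Module Rᵐᵒᵖ N] (x : N) :
    RightIdeal R :=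
  LinearMap.ker (orbitMap R x)

variable {N P : Type*} [AddCommGroup N] [Module Rᵐᵒᵖ N] [AddCommGroup P] [Module Rᵐᵒᵖ P]

theorem mem_rightAnn {x : N} {r : R} : r ∈ rightAnn R x ↔ MulOpposite.op r • x = 0 := Iff.rfl

theorem rightAnn_zero : rightAnn R (0 : N) = ⊤ := by
  ext r; simp [mem_rightAnn]

theorem rightAnn_le_map (f : N →ₗ[Rᵐᵒᵖ] P) (x : N) : rightAnn R x ≤ rightAnn R (f x) := by
  intro r hr
  rw [mem_rightAnn] at hr ⊢
  rw [← map_smul, hr, map_zero]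

theorem rightAnn_map (f : N →ₗ[Rᵐᵒᵖ] P) (hf : Function.Injective f) (x : N) :
    rightAnn R (f x) = rightAnn R x := by
  ext r
  rw [mem_rightAnn, mem_rightAnn, ← map_smul, map_eq_zero_iff f hf]

theorem inf_rightAnn_le (x y : N) : rightAnn R x ⊓ rightAnn R y ≤ rightAnn R (x + y) := by
  rintro r ⟨hx, hy⟩
  rw [SetLike.mem_coe, mem_rightAnn] at hx hy
  rw [mem_rightAnn, smul_add, hx, hy, add_zero]

theorem rightAnn_smul (x : N) (r : R) :
    rightAnn R (MulOpposite.op r • x) = (rightAnn R x).residual r := by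
  ext s
  change _ ↔ r * s ∈ rightAnn R x
  rw [mem_rightAnn, mem_rightAnn, ← mul_smul, MulOpposite.op_mul]

theorem rightAnn_mk_one (I : RightIdeal R) :
    rightAnn R (Submodule.Quotient.mk 1 : R ⧸ I) = I := by
  ext r
  rw [mem_rightAnn, ← Submodule.Quotient.mk_smul, Submodule.Quotient.mk_eq_zero]
  simp

theorem isCoatom_rightAnn [IsSimpleModule Rᵐᵒᵖ N] {x : N} (hx : x ≠ 0) :
    IsCoatom (rightAnn R x) := by
  refine LinearMap.isCoatom_ker_of_surjective ((LinearMap.surjective_or_eq_zero _).resolve_right ?_)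
  intro h
  exact hx (by simpa [orbitMap] using LinearMap.congr_fun h (1 : R))

/-- The cyclic module `R ⧸ rightAnn R x` embeds as the submodule generated by `x`. -/
theorem exists_injective_quotient_rightAnn (x : N) :
    ∃ f : (R ⧸ rightAnn R x) →ₗ[Rᵐᵒᵖ] N, Function.Injective f ∧
      f (Submodule.Quotient.mk 1) = x := by
  refine ⟨(rightAnn R x).liftQ (orbitMap R x) (le_refl (rightAnn R x)),
    LinearMap.ker_eq_bot.1 (Submodule.ker_liftQ_eq_bot _ _ _ (le_refl (rightAnn R x))), ?_⟩
  exact one_smul Rᵐᵒᵖ x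

end Annihilators

/-! ### Wisbauer classes, linear filters and left exact preradicals -/

section Correspondences

variable {R : Type u} [Ring R]

namespace WisbauerClass

theorem mem_of_injective (W : WisbauerClass R) {M N : RightMod R} (f : M →ₗ[Rᵐᵒᵖ] N)
    (hf : Function.Injective f) (hN : N ∈ W.carrier) : M ∈ W.carrier :=
  W.image_mem _ _ (LinearEquiv.ofInjective f hf).symm.toLinearMap
    (LinearEquiv.ofInjective f hf).symm.surjective (W.submodule_mem N (LinearMap.range f) hN)

theorem quotient_rightAnn_mem (W : WisbauerClass R) {N : RightMod R} (hN : N ∈ W.carrier)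
    (x : N) : ModuleCat.of Rᵐᵒᵖ (R ⧸ rightAnn R x) ∈ W.carrier := by
  obtain ⟨f, hf, -⟩ := exists_injective_quotient_rightAnn (R := R) x
  exact W.mem_of_injective f hf hN

/-- A module is a quotient of the direct sum of its cyclic submodules. -/
theorem mem_iff_quotient_rightAnn_mem (W : WisbauerClass R) (N : RightMod R) :
    N ∈ W.carrier ↔ ∀ x : N, ModuleCat.of Rᵐᵒᵖ (R ⧸ rightAnn R x) ∈ W.carrier := by
  classical
  refine ⟨fun hN => W.quotient_rightAnn_mem hN, fun h => ?_⟩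
  choose f _ hf1 using fun x : N => exists_injective_quotient_rightAnn (R := R) x
  refine W.image_mem _ N (DirectSum.toModule Rᵐᵒᵖ N N f) (fun x => ?_)
    (W.directSum_mem N (fun x => ModuleCat.of Rᵐᵒᵖ (R ⧸ rightAnn R x)) h)
  exact ⟨DirectSum.lof Rᵐᵒᵖ N (fun x : N => R ⧸ rightAnn R x) x
    (Submodule.Quotient.mk 1), (DirectSum.toModule_lof Rᵐᵒᵖ x _).trans (hf1 x)⟩

theorem quotient_mem_of_le (W : WisbauerClass R) {I J : RightIdeal R} (hIJ : I ≤ J)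
    (hI : ModuleCat.of Rᵐᵒᵖ (R ⧸ I) ∈ W.carrier) : ModuleCat.of Rᵐᵒᵖ (R ⧸ J) ∈ W.carrier :=
  W.image_mem _ _ (Submodule.factor hIJ) (Submodule.factor_surjective hIJ) hI

/-- The right ideals `I` such that `R ⧸ I` lies in a given Wisbauer class. -/
def toLinearFilter (W : WisbauerClass R) : LinearFilter R where
  carrier := {I | ModuleCat.of Rᵐᵒᵖ (R ⧸ I) ∈ W.carrier}
  top_mem := by
    -- the zero module is an empty direct sum
    have h := W.directSum_mem PEmpty (fun _ => ModuleCat.of Rᵐᵒᵖ PUnit) (fun i => i.elim)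
    have := W.quotient_rightAnn_mem h 0
    rwa [rightAnn_zero] at this
  inf_mem I J hI hJ := by
    classical
    let N : ULift.{u} Bool → RightMod R := fun b =>
      ModuleCat.of Rᵐᵒᵖ (R ⧸ (if b.down then I else J))
    have h := W.directSum_mem (ULift.{u} Bool) N (by rintro ⟨_ | _⟩ <;> assumption)
    -- `I ⊓ J` contains the annihilator of the element of the direct sum with both entries `1`
    let x : ⨁ b, N b := DirectSum.lof Rᵐᵒᵖ _ (fun b => N b) ⟨true⟩ (Submodule.Quotient.mk 1) +
      DirectSum.lof Rᵐᵒᵖ _ (fun b => N b) ⟨false⟩ (Submodule.Quotient.mk 1)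
    refine W.quotient_mem_of_le (le_inf ?_ ?_) (W.quotient_rightAnn_mem h x)
    · refine (rightAnn_le_map (DirectSum.component Rᵐᵒᵖ _ (fun b => N b) ⟨true⟩) x).trans ?_
      rw [map_add, DirectSum.component.lof_self, DirectSum.component.of, dif_neg (by simp),
        add_zero]
      exact (rightAnn_mk_one I).le
    · refine (rightAnn_le_map (DirectSum.component Rᵐᵒᵖ _ (fun b => N b) ⟨false⟩) x).trans ?_
      rw [map_add, DirectSum.component.lof_self, DirectSum.component.of, dif_neg (by simp),
        zero_add]
      exact (rightAnn_mk_one J).le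
  mem_of_le I J hI hIJ := W.quotient_mem_of_le hIJ hI
  residual_mem I r hI := by
    have := W.quotient_rightAnn_mem hI
      (MulOpposite.op r • (Submodule.Quotient.mk 1 : R ⧸ I))
    rwa [rightAnn_smul, rightAnn_mk_one] at this

end WisbauerClass

namespace LinearFilter

/-- The torsion submodule of a module with respect to a linear filter: the elements whose
annihilator belongs to the filter. -/
def torsion (F : LinearFilter R) (N : Type*) [AddCommGroup N] [Module Rᵐᵒᵖ N] :
    Submodule Rᵐᵒᵖ N where
  carrier := {x | rightAnn R x ∈ F.carrier}
  add_mem' hx hy := F.mem_of_le _ _ (F.inf_mem _ _ hx hy) (inf_rightAnn_le _ _)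
  zero_mem' := by
    change rightAnn R (0 : N) ∈ F.carrier
    rw [rightAnn_zero]
    exact F.top_mem
  smul_mem' c x hx := by
    change rightAnn R (MulOpposite.op c.unop • x) ∈ F.carrier
    rw [rightAnn_smul]
    exact F.residual_mem _ _ hx

variable {N P : Type*} [AddCommGroup N] [Module Rᵐᵒᵖ N] [AddCommGroup P] [Module Rᵐᵒᵖ P]

theorem mem_torsion {F : LinearFilter R} {x : N} :
    x ∈ F.torsion N ↔ rightAnn R x ∈ F.carrier := Iff.rfl

theorem map_mem_torsion {F : LinearFilter R} (f : N →ₗ[Rᵐᵒᵖ] P) {x : N} (hx : x ∈ F.torsion N) :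
    f x ∈ F.torsion P :=
  F.mem_of_le _ _ hx (rightAnn_le_map f x)

theorem map_mem_torsion_iff {F : LinearFilter R} (f : N →ₗ[Rᵐᵒᵖ] P) (hf : Function.Injective f)
    {x : N} : f x ∈ F.torsion P ↔ x ∈ F.torsion N := by
  rw [mem_torsion, mem_torsion, rightAnn_map f hf]

/-- The modules all of whose elements are torsion with respect to a given linear filter. -/
def toWisbauerClass (F : LinearFilter R) : WisbauerClass R where
  carrier := {N | ∀ x : N, x ∈ F.torsion N}
  image_mem M N f hf hM y := by
    obtain ⟨x, rfl⟩ := hf y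
    exact map_mem_torsion f (hM x)
  submodule_mem M K hM x := (map_mem_torsion_iff K.subtype K.injective_subtype).1 (hM x)
  directSum_mem ι N hN x := by
    classical
    change x ∈ F.torsion (⨁ i, N i)
    induction x using DirectSum.induction_on with
    | zero => exact zero_mem _
    | of i y => exact map_mem_torsion (DirectSum.lof Rᵐᵒᵖ ι (fun i => N i) i) (hN i y)
    | add x y hx hy => exact add_mem hx hy

/-- Torsion with respect to a linear filter, as a preradical. -/
def toPreradical (F : LinearFilter R) : LeftExactPreradical R where
  toFun M := F.torsion M
  map_le M N f := by
    rintro _ ⟨x, hx, rfl⟩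
    exact map_mem_torsion f hx
  submodule_eq M K := by
    ext x
    exact (map_mem_torsion_iff K.subtype K.injective_subtype).symm

/-- `R ⧸ I` is torsion as soon as its generator, whose annihilator is `I`, is torsion. -/
theorem quotient_torsion_iff (F : LinearFilter R) (I : RightIdeal R) :
    (∀ x : R ⧸ I, x ∈ F.torsion (R ⧸ I)) ↔ I ∈ F.carrier := by
  refine ⟨fun h => ?_, fun h x => ?_⟩
  · simpa only [mem_torsion, rightAnn_mk_one] using h (Submodule.Quotient.mk 1)
  · obtain ⟨r, rfl⟩ := Submodule.Quotient.mk_surjective I x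
    have h1 : (Submodule.Quotient.mk 1 : R ⧸ I) ∈ F.torsion (R ⧸ I) := by
      rwa [mem_torsion, rightAnn_mk_one]
    have := (F.torsion (R ⧸ I)).smul_mem (MulOpposite.op r) h1
    rwa [← Submodule.Quotient.mk_smul, op_smul_eq_mul, one_mul] at this

end LinearFilter

/-- Wisbauer classes correspond to linear filters. -/
def wisbauerClassEquivLinearFilter (R : Type u) [Ring R] : WisbauerClass R ≃o LinearFilter R where
  toFun := WisbauerClass.toLinearFilter
  invFun := LinearFilter.toWisbauerClass
  left_inv W := WisbauerClass.ext <| Set.ext fun N => (W.mem_iff_quotient_rightAnn_mem N).symm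
  right_inv F := LinearFilter.ext <| Set.ext fun I => F.quotient_torsion_iff I
  map_rel_iff' {V W} := by
    refine ⟨fun h N hN => ?_, fun h I hI => h hI⟩
    exact (W.mem_iff_quotient_rightAnn_mem N).2 fun x => h (V.quotient_rightAnn_mem hN x)

namespace LeftExactPreradical

theorem map_mem (τ : LeftExactPreradical R) {M N : RightMod R} (f : M →ₗ[Rᵐᵒᵖ] N) {x : M}
    (hx : x ∈ τ.toFun M) : f x ∈ τ.toFun N :=
  τ.map_le M N f ⟨x, hx, rfl⟩

theorem map_mem_iff (τ : LeftExactPreradical R) {M N : RightMod R} (f : M →ₗ[Rᵐᵒᵖ] N)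
    (hf : Function.Injective f) {x : M} : f x ∈ τ.toFun N ↔ x ∈ τ.toFun M := by
  refine ⟨fun hx => ?_, τ.map_mem f⟩
  let e := LinearEquiv.ofInjective f hf
  have h : e x ∈ τ.toFun (ModuleCat.of Rᵐᵒᵖ (LinearMap.range f)) := by
    rw [τ.submodule_eq]
    exact hx
  have := τ.map_mem (M := ModuleCat.of Rᵐᵒᵖ (LinearMap.range f)) e.symm.toLinearMap h
  simpa using this

theorem mem_iff_mk_one_mem (τ : LeftExactPreradical R) {N : RightMod R} (x : N) :
    x ∈ τ.toFun N ↔ (Submodule.Quotient.mk 1 : R ⧸ rightAnn R x) ∈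
      τ.toFun (ModuleCat.of Rᵐᵒᵖ (R ⧸ rightAnn R x)) := by
  obtain ⟨f, hf, hf1⟩ := exists_injective_quotient_rightAnn (R := R) x
  rw [← τ.map_mem_iff (M := ModuleCat.of Rᵐᵒᵖ (R ⧸ rightAnn R x)) f hf, hf1]

theorem mem_of_rightAnn_le (τ : LeftExactPreradical R) {M N : RightMod R} {x : M} {y : N}
    (hxy : rightAnn R x ≤ rightAnn R y) (hx : x ∈ τ.toFun M) : y ∈ τ.toFun N := by
  rw [mem_iff_mk_one_mem] at hx ⊢
  exact τ.map_mem (M := ModuleCat.of Rᵐᵒᵖ (R ⧸ rightAnn R x))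
    (N := ModuleCat.of Rᵐᵒᵖ (R ⧸ rightAnn R y)) (Submodule.factor hxy) hx

/-- The right ideals `I` such that `τ (R ⧸ I) = R ⧸ I`, expressed through the generator. -/
def toLinearFilter (τ : LeftExactPreradical R) : LinearFilter R where
  carrier := {I | (Submodule.Quotient.mk 1 : R ⧸ I) ∈ τ.toFun (ModuleCat.of Rᵐᵒᵖ (R ⧸ I))}
  top_mem := by
    have h := (τ.toFun (ModuleCat.of Rᵐᵒᵖ PUnit)).zero_mem
    rwa [mem_iff_mk_one_mem, rightAnn_zero] at h
  inf_mem I J hI hJ := by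
    let x : R ⧸ I := Submodule.Quotient.mk 1
    let y : R ⧸ J := Submodule.Quotient.mk 1
    have hx := τ.map_mem (M := ModuleCat.of Rᵐᵒᵖ (R ⧸ I))
      (N := ModuleCat.of Rᵐᵒᵖ ((R ⧸ I) × (R ⧸ J))) (LinearMap.inl Rᵐᵒᵖ _ _) hI
    have hy := τ.map_mem (M := ModuleCat.of Rᵐᵒᵖ (R ⧸ J))
      (N := ModuleCat.of Rᵐᵒᵖ ((R ⧸ I) × (R ⧸ J))) (LinearMap.inr Rᵐᵒᵖ _ _) hJ
    refine τ.mem_of_rightAnn_le ?_ (add_mem hx hy)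
    rw [rightAnn_mk_one]
    refine le_inf ?_ ?_
    · refine (rightAnn_le_map (LinearMap.fst Rᵐᵒᵖ (R ⧸ I) (R ⧸ J)) _).trans ?_
      simpa using (rightAnn_mk_one I).le
    · refine (rightAnn_le_map (LinearMap.snd Rᵐᵒᵖ (R ⧸ I) (R ⧸ J)) _).trans ?_
      simpa using (rightAnn_mk_one J).le
  mem_of_le I J hI hIJ := by
    refine τ.mem_of_rightAnn_le (M := ModuleCat.of Rᵐᵒᵖ (R ⧸ I)) ?_ hI
    exact ((rightAnn_mk_one I).trans_le hIJ).trans (rightAnn_mk_one J).ge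
  residual_mem I r hI := by
    have := (τ.toFun (ModuleCat.of Rᵐᵒᵖ (R ⧸ I))).smul_mem (MulOpposite.op r) hI
    refine τ.mem_of_rightAnn_le ?_ this
    rw [rightAnn_smul, rightAnn_mk_one, rightAnn_mk_one]

end LeftExactPreradical

/-- Linear filters correspond to left exact preradicals. -/
def linearFilterEquivPreradical (R : Type u) [Ring R] :
    LinearFilter R ≃o LeftExactPreradical R where
  toFun := LinearFilter.toPreradical
  invFun := LeftExactPreradical.toLinearFilter
  left_inv F := LinearFilter.ext <| Set.ext fun I => by
    change rightAnn R (Submodule.Quotient.mk 1 : R ⧸ I) ∈ F.carrier ↔ _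
    rw [rightAnn_mk_one]
  right_inv τ := LeftExactPreradical.ext <| funext fun N => Submodule.ext fun x =>
    (τ.mem_iff_mk_one_mem x).symm
  map_rel_iff' {F G} := by
    refine ⟨fun h I hI => ?_, fun h N x hx => h hx⟩
    have := h (ModuleCat.of Rᵐᵒᵖ (R ⧸ I))
      (show (Submodule.Quotient.mk 1 : R ⧸ I) ∈ F.torsion (R ⧸ I) by
        rwa [LinearFilter.mem_torsion, rightAnn_mk_one])
    change rightAnn R (Submodule.Quotient.mk 1 : R ⧸ I) ∈ G.carrier at this
    rwa [rightAnn_mk_one] at this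

end Correspondences

/-! ### The socle -/

section Socle

variable {R : Type u} [Ring R]

theorem moduleSocle_eq_top (M : RightMod R) [IsSemisimpleModule Rᵐᵒᵖ M] : moduleSocle M = ⊤ :=
  IsSemisimpleModule.sSup_simples_eq_top Rᵐᵒᵖ M

theorem map_moduleSocle_le {M N : RightMod R} (f : M →ₗ[Rᵐᵒᵖ] N) :
    (moduleSocle M).map f ≤ moduleSocle N := by
  rw [Submodule.map_le_iff_le_comap]
  refine sSup_le fun S (hS : IsSimpleModule Rᵐᵒᵖ S) => ?_
  rw [← Submodule.map_le_iff_le_comap]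
  rcases LinearMap.injective_or_eq_zero (f ∘ₗ S.subtype) with h | h
  · refine le_sSup ?_
    have e := LinearEquiv.ofInjective _ h
    rw [LinearMap.range_comp, Submodule.range_subtype] at e
    exact IsSimpleModule.congr e.symm
  · rintro _ ⟨x, hx, rfl⟩
    have : f x = 0 := LinearMap.congr_fun h ⟨x, hx⟩
    rw [this]
    exact zero_mem _

theorem LinearFilter.moduleSocle_le_torsion {F : LinearFilter R}
    (hF : ∀ I : RightIdeal R, IsCoatom I → I ∈ F.carrier) (M : RightMod R) :
    moduleSocle M ≤ F.torsion M := by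
  refine sSup_le fun S (hS : IsSimpleModule Rᵐᵒᵖ S) x hx => ?_
  by_cases h0 : x = 0
  · rw [h0]
    exact zero_mem _
  · refine (map_mem_torsion_iff S.subtype S.injective_subtype (x := ⟨x, hx⟩)).2 ?_
    exact hF _ (isCoatom_rightAnn fun h => h0 (congrArg Subtype.val h))

theorem ssMod_le_iff (W : WisbauerClass R) :
    ssMod R ≤ W ↔
      ∀ I : RightIdeal R, IsCoatom I → I ∈ (wisbauerClassEquivLinearFilter R W).carrier := by
  refine ⟨fun h I hI => ?_, fun h => ?_⟩
  · have := isSimpleModule_iff_isCoatom.2 hI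
    exact h (show IsSemisimpleModule Rᵐᵒᵖ (R ⧸ I) from inferInstance)
  · rw [← (wisbauerClassEquivLinearFilter R).symm_apply_apply W]
    intro N (hN : IsSemisimpleModule Rᵐᵒᵖ N) x
    apply LinearFilter.moduleSocle_le_torsion h N
    rw [moduleSocle_eq_top]
    exact Submodule.mem_top

/-- For a linear filter, containing the maximal right ideals means that simple modules are
torsion. -/
theorem isCoatom_mem_iff (F : LinearFilter R) :
    (∀ I : RightIdeal R, IsCoatom I → I ∈ F.carrier) ↔
      ∀ M : RightMod R, moduleSocle M ≤ (linearFilterEquivPreradical R F).toFun M := by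
  refine ⟨LinearFilter.moduleSocle_le_torsion, fun h I hI => ?_⟩
  have := isSimpleModule_iff_isCoatom.2 hI
  refine (F.quotient_torsion_iff I).1 fun x => h (ModuleCat.of Rᵐᵒᵖ (R ⧸ I)) ?_
  have : IsSemisimpleModule Rᵐᵒᵖ (ModuleCat.of Rᵐᵒᵖ (R ⧸ I)) :=
    inferInstanceAs (IsSemisimpleModule Rᵐᵒᵖ (R ⧸ I))
  rw [moduleSocle_eq_top]
  exact Submodule.mem_top

end Socle

/-! ### Main injective modules -/

section MainInjective

variable {R : Type u} [Ring R]

theorem exists_injective_embedding (N : RightMod R) :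
    ∃ (E : RightMod R) (i : N →ₗ[Rᵐᵒᵖ] E), Module.Injective Rᵐᵒᵖ E ∧ Function.Injective i := by
  obtain ⟨⟨E, _, i, _⟩⟩ := CategoryTheory.EnoughInjectives.presentation (C := RightMod R) N
  have : CategoryTheory.Injective (ModuleCat.of Rᵐᵒᵖ E) :=
    inferInstanceAs (CategoryTheory.Injective E)
  exact ⟨E, i.hom, Module.injective_module_of_injective_object Rᵐᵒᵖ E,
    (ModuleCat.mono_iff_injective i).1 inferInstance⟩

/-- An injective module containing every cyclic module is a main injective module: the embedding
of the submodule generated by `x : N` extends to a map from `N` under which the image of `x` has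
the same annihilator as `x`. -/
theorem isMainInjective_of_cyclic {E : RightMod R} [Module.Injective Rᵐᵒᵖ E]
    (h : ∀ I : RightIdeal R, ∃ f : (R ⧸ I) →ₗ[Rᵐᵒᵖ] E, Function.Injective f) :
    IsMainInjective E := by
  refine ⟨inferInstance, fun τ N => le_antisymm ?_ fun x hx => ?_⟩
  · exact le_iInf fun f x hx => τ.map_mem f hx
  · obtain ⟨g, hg⟩ := h (rightAnn R x)
    obtain ⟨i, hi, hi1⟩ := exists_injective_quotient_rightAnn (R := R) x
    obtain ⟨f, hf⟩ := Module.Injective.out i hi g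
    have hfx := (Submodule.mem_iInf _).1 hx f
    refine τ.mem_of_rightAnn_le ?_ (Submodule.mem_comap.1 hfx)
    rw [← hi1, hf, rightAnn_map g hg, rightAnn_map i hi]

theorem exists_isMainInjective (R : Type u) [Ring R] : ∃ E : RightMod R, IsMainInjective E := by
  classical
  obtain ⟨E, i, hE, hi⟩ := exists_injective_embedding
    (ModuleCat.of Rᵐᵒᵖ (⨁ I : RightIdeal R, R ⧸ I))
  refine ⟨E, isMainInjective_of_cyclic fun I => ?_⟩
  exact ⟨i ∘ₗ DirectSum.lof Rᵐᵒᵖ _ (fun I : RightIdeal R => R ⧸ I) I,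
    hi.comp (DirectSum.of_injective (β := fun I : RightIdeal R => R ⧸ I) I)⟩

/-- The preradical `N ↦ ⋂ {f⁻¹(A) : f ∈ Hom(N, E)}` given by a submodule `A` of an injective
module `E`; injectivity of `E` makes it left exact. -/
def LeftExactPreradical.ofSubmodule {E : RightMod R} (hE : Module.Injective Rᵐᵒᵖ E)
    (A : Submodule Rᵐᵒᵖ E) : LeftExactPreradical R where
  toFun N := ⨅ f : N →ₗ[Rᵐᵒᵖ] E, A.comap f
  map_le M N g := by
    rintro _ ⟨x, hx, rfl⟩
    simp only [SetLike.mem_coe, Submodule.mem_iInf, Submodule.mem_comap] at hx ⊢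
    exact fun f => hx (f ∘ₗ g)
  submodule_eq M K := by
    ext x
    simp only [Submodule.mem_iInf, Submodule.mem_comap]
    refine ⟨fun h f => h (f ∘ₗ K.subtype), fun h f => ?_⟩
    obtain ⟨g, hg⟩ := hE.out K.subtype K.injective_subtype f
    have := h g
    rwa [hg] at this

/-- Evaluation at a main injective module `E` identifies the left exact preradicals with the fully
invariant submodules of `E`. -/
def preradicalEquivFullyInvariant {E : RightMod R} (hE : IsMainInjective E) :
    LeftExactPreradical R ≃o fullyInvariantSubmodule Rᵐᵒᵖ E where
  toFun τ := ⟨τ.toFun E, fun f => Submodule.map_le_iff_le_comap.1 (τ.map_le E E f)⟩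
  invFun A := .ofSubmodule hE.1 A
  left_inv τ := LeftExactPreradical.ext <| funext fun N => (hE.2 τ N).symm
  right_inv A := Subtype.ext <| le_antisymm (iInf_le _ LinearMap.id) (le_iInf fun f => A.2 f)
  map_rel_iff' {σ τ} := by
    refine ⟨fun h N => ?_, fun h => h E⟩
    rw [hE.2 σ, hE.2 τ]
    exact iInf_mono fun f => Submodule.comap_mono h

theorem moduleSocle_le_preradical_iff {E : RightMod R} (hE : IsMainInjective E)
    (τ : LeftExactPreradical R) :
    (∀ M : RightMod R, moduleSocle M ≤ τ.toFun M) ↔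
      moduleSocle E ≤ (preradicalEquivFullyInvariant hE τ : Submodule Rᵐᵒᵖ E) := by
  refine ⟨fun h => h E, fun h M => ?_⟩
  rw [hE.2 τ M]
  exact le_iInf fun f => Submodule.map_le_iff_le_comap.1 ((map_moduleSocle_le f).trans h)

end MainInjective

/-! ### Injectivity domains and the injective profile -/

section InjectivityDomains

variable {R : Type u} [Ring R]

/-- The injectivity domain of a module, as a Wisbauer class. -/
def injectivityDomainClass (M : RightMod R) : WisbauerClass R where
  carrier := injectivityDomain M
  image_mem _ _ f hf h := ExtendsFromSubmodules.of_surjective h f hf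
  submodule_mem _ K h := ExtendsFromSubmodules.of_injective h K.subtype K.injective_subtype
  directSum_mem _ N h := ExtendsFromSubmodules.directSum (fun i => N i) h

theorem ssMod_le_injectivityDomainClass (M : RightMod R) : ssMod R ≤ injectivityDomainClass M :=
  fun _ (_ : IsSemisimpleModule Rᵐᵒᵖ _) => ExtendsFromSubmodules.of_isSemisimpleModule

/-- The torsion submodule of an injective module `E` is injective relative to every torsion module
`N`, because the image of a map `N → E` is torsion. -/
theorem extendsFromSubmodules_torsion {F : LinearFilter R} {E : RightMod R}
    (hE : Module.Injective Rᵐᵒᵖ E) {N : RightMod R} (hN : N ∈ F.toWisbauerClass.carrier) :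
    ExtendsFromSubmodules Rᵐᵒᵖ (F.torsion E) N := by
  intro K φ
  obtain ⟨ψ, hψ⟩ := hE.out K.subtype K.injective_subtype ((F.torsion E).subtype ∘ₗ φ)
  exact ⟨ψ.codRestrict _ fun x => LinearFilter.map_mem_torsion ψ (hN x),
    fun x => Subtype.ext (hψ x)⟩

/-- There are no nonzero maps from torsion to torsion-free modules. -/
theorem extendsFromSubmodules_of_torsion_eq_bot {F : LinearFilter R} {L : Type*}
    [AddCommGroup L] [Module Rᵐᵒᵖ L] (hL : F.torsion L = ⊥) {N : RightMod R}
    (hN : N ∈ F.toWisbauerClass.carrier) : ExtendsFromSubmodules Rᵐᵒᵖ L N := by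
  intro K φ
  refine ⟨0, fun x => ?_⟩
  have hx := LinearFilter.map_mem_torsion φ
    ((LinearFilter.map_mem_torsion_iff (F := F) K.subtype K.injective_subtype).1 (hN x))
  rw [hL, Submodule.mem_bot] at hx
  exact hx.symm

/-- A module `N` that is not torsion is separated from all torsion modules by some injectivity
domain. If `N` has a nonzero torsion-free submodule `K`, then `K` has no simple submodule, so it is
not semisimple and some submodule `L` of `K` is not `K`-injective; being torsion-free, `L` is
injective relative to all torsion modules. Otherwise the torsion submodule of `N` is essential;
for an injective module `E ⊇ N`, an extension to `N` of the inclusion of the torsion submodules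
would be a monomorphism from `N` to the torsion submodule of `E`. -/
theorem exists_separating_module {F : LinearFilter R}
    (hF : ∀ I : RightIdeal R, IsCoatom I → I ∈ F.carrier) {N : RightMod R}
    (hN : N ∉ F.toWisbauerClass.carrier) :
    ∃ M : RightMod R, F.toWisbauerClass.carrier ⊆ injectivityDomain M ∧
      N ∉ injectivityDomain M := by
  by_cases hK : ∃ K : Submodule Rᵐᵒᵖ N, K ≠ ⊥ ∧ F.torsion K = ⊥
  · obtain ⟨K, hK0, hKF⟩ := hK
    have hss : ¬ IsSemisimpleModule Rᵐᵒᵖ K := by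
      intro hss
      have htop : moduleSocle (ModuleCat.of Rᵐᵒᵖ K) = ⊤ :=
        IsSemisimpleModule.sSup_simples_eq_top Rᵐᵒᵖ K
      have hle := LinearFilter.moduleSocle_le_torsion hF (ModuleCat.of Rᵐᵒᵖ K)
      rw [htop] at hle
      have hbot : (⊤ : Submodule Rᵐᵒᵖ K) = ⊥ := le_bot_iff.1 (hle.trans hKF.le)
      exact hK0 (by rw [← Submodule.map_subtype_top K, hbot, Submodule.map_bot])
    obtain ⟨L, hL⟩ : ∃ L : Submodule Rᵐᵒᵖ K, ¬ ExtendsFromSubmodules Rᵐᵒᵖ L K := by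
      by_contra! h
      exact hss (ExtendsFromSubmodules.isSemisimpleModule_of_submodules h)
    have hLF : F.torsion L = ⊥ := by
      refine le_bot_iff.1 fun x hx => ?_
      have := LinearFilter.map_mem_torsion L.subtype hx
      rw [hKF, Submodule.mem_bot] at this
      exact Subtype.ext this
    refine ⟨ModuleCat.of Rᵐᵒᵖ L, fun X hX => extendsFromSubmodules_of_torsion_eq_bot hLF hX,
      fun h => hL ?_⟩
    exact ExtendsFromSubmodules.of_injective h K.subtype K.injective_subtype
  · obtain ⟨E, i, hE, hi⟩ := exists_injective_embedding N
    refine ⟨ModuleCat.of Rᵐᵒᵖ (F.torsion E), fun X hX => extendsFromSubmodules_torsion hE hX,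
      fun h => hN fun x => ?_⟩
    obtain ⟨g, hg⟩ := h (F.torsion N) (i.restrict fun x hx => LinearFilter.map_mem_torsion i hx)
    have hker : LinearMap.ker g = ⊥ := by
      by_contra h0
      refine hK ⟨LinearMap.ker g, h0, le_bot_iff.1 fun x hx => ?_⟩
      have hx' := LinearFilter.map_mem_torsion (LinearMap.ker g).subtype hx
      have h1 : i x = 0 := by
        have := hg ⟨x, hx'⟩
        rw [show g x = 0 from x.2] at this
        exact (congrArg Subtype.val this).symm
      exact Subtype.ext ((map_eq_zero_iff i hi).1 h1)
    have hgx : g x ∈ F.torsion (F.torsion E) :=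
      (LinearFilter.map_mem_torsion_iff (F.torsion E).subtype
        (F.torsion E).injective_subtype).1 (g x).2
    exact (LinearFilter.map_mem_torsion_iff g (LinearMap.ker_eq_bot.1 hker)).1 hgx

/-- A linear filter containing all maximal right ideals determines the injectivity domain of some
module, namely of the product over all cyclic modules that are not torsion of modules separating
them from the torsion modules. -/
theorem exists_injectivityDomain_eq {F : LinearFilter R}
    (hF : ∀ I : RightIdeal R, IsCoatom I → I ∈ F.carrier) :
    ∃ M : RightMod R, injectivityDomain M = F.toWisbauerClass.carrier := by
  have hsep : ∀ I : {I : RightIdeal R // I ∉ F.carrier}, ∃ M : RightMod R,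
      F.toWisbauerClass.carrier ⊆ injectivityDomain M ∧
        ModuleCat.of Rᵐᵒᵖ (R ⧸ I.1) ∉ injectivityDomain M := fun I =>
    exists_separating_module hF fun h => I.2 ((F.quotient_torsion_iff I.1).1 h)
  choose M hM hM' using hsep
  refine ⟨ModuleCat.of Rᵐᵒᵖ (∀ I, M I), Set.Subset.antisymm (fun N hN x => ?_) fun N hN => ?_⟩
  · by_contra hx
    have hdom := (ExtendsFromSubmodules.pi_iff fun I => M I).1 hN
    exact hM' ⟨rightAnn R x, hx⟩
      ((injectivityDomainClass (M ⟨rightAnn R x, hx⟩)).quotient_rightAnn_mem (hdom _) x)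
  · exact (ExtendsFromSubmodules.pi_iff fun I => M I).2 fun I => hM I hN

theorem exists_injectivityDomain_eq_carrier (W : WisbauerClass R) (hW : ssMod R ≤ W) :
    ∃ M : RightMod R, injectivityDomain M = W.carrier := by
  obtain ⟨M, hM⟩ := exists_injectivityDomain_eq ((ssMod_le_iff W).1 hW)
  refine ⟨M, hM.trans ?_⟩
  exact congrArg WisbauerClass.carrier ((wisbauerClassEquivLinearFilter R).symm_apply_apply W)

theorem iProfile_eq_image_Icc (R : Type u) [Ring R] :
    iProfile R = WisbauerClass.carrier '' Set.Icc (ssMod R) ⊤ := by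
  ext A
  constructor
  · rintro ⟨M, rfl⟩
    exact ⟨injectivityDomainClass M, ⟨ssMod_le_injectivityDomainClass M, le_top⟩, rfl⟩
  · rintro ⟨W, hW, rfl⟩
    obtain ⟨M, hM⟩ := exists_injectivityDomain_eq_carrier W hW.1
    exact ⟨M, hM.symm⟩

/-- The injective profile as an interval of the lattice of Wisbauer classes. -/
noncomputable def iProfileEquiv (R : Type u) [Ring R] :
    iProfile R ≃o {W : WisbauerClass R // ssMod R ≤ W} :=
  let f : {W : WisbauerClass R // ssMod R ≤ W} ↪o iProfile R :=
    OrderEmbedding.ofMapLEIff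
      (fun W => ⟨W.1.carrier, iProfile_eq_image_Icc R ▸ ⟨W.1, ⟨W.2, le_top⟩, rfl⟩⟩)
      fun _ _ => Iff.rfl
  OrderIso.symm <| RelIso.ofSurjective f <| by
    rintro ⟨_, M, rfl⟩
    exact ⟨⟨injectivityDomainClass M, ssMod_le_injectivityDomainClass M⟩, rfl⟩

/-- The restriction of an order isomorphism to corresponding subtypes. -/
def OrderIso.restrictSubtype {α β : Type*} [LE α] [LE β] (e : α ≃o β) {p : α → Prop}
    {q : β → Prop} (h : ∀ a, p a ↔ q (e a)) : {a // p a} ≃o {b // q b} where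
  toEquiv := e.toEquiv.subtypeEquiv h
  map_rel_iff' := e.map_rel_iff

end InjectivityDomains

theorem theorem2p6 (R : Type u) [Ring R] :
    -- every Wisbauer class containing the semisimple modules is an injectivity domain
    (∀ W : WisbauerClass R, ssMod R ≤ W → ∃ M : RightMod R, injectivityDomain M = W.carrier) ∧
    -- the injective profile is the interval from the semisimple modules to all modules
    iProfile R = WisbauerClass.carrier '' Set.Icc (ssMod R) ⊤ ∧
    -- linear filters containing all maximal right ideals
    Nonempty (iProfile R ≃o
      {F : LinearFilter R // ∀ I : RightIdeal R, IsCoatom I → I ∈ F.carrier}) ∧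
    -- left exact preradicals above the socle
    Nonempty (iProfile R ≃o
      {τ : LeftExactPreradical R // ∀ M : RightMod R, moduleSocle M ≤ τ.toFun M}) ∧
    -- main injective modules exist, and for any of them: fully invariant submodules
    -- containing the socle
    (∃ E : RightMod R, IsMainInjective E) ∧
    (∀ E : RightMod R, IsMainInjective E →
      Nonempty (iProfile R ≃o
        {A : fullyInvariantSubmodule Rᵐᵒᵖ E // moduleSocle E ≤ (A : Submodule Rᵐᵒᵖ E)})) := by
  let e₁ := (iProfileEquiv R).trans
    ((wisbauerClassEquivLinearFilter R).restrictSubtype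
      (q := fun F => ∀ I : RightIdeal R, IsCoatom I → I ∈ F.carrier) ssMod_le_iff)
  let e₂ := e₁.trans ((linearFilterEquivPreradical R).restrictSubtype
    (q := fun τ => ∀ M : RightMod R, moduleSocle M ≤ τ.toFun M) isCoatom_mem_iff)
  exact ⟨exists_injectivityDomain_eq_carrier, iProfile_eq_image_Icc R, ⟨e₁⟩, ⟨e₂⟩,
    exists_isMainInjective R, fun E hE => ⟨e₂.trans
      ((preradicalEquivFullyInvariant hE).restrictSubtype
        (q := fun A => moduleSocle E ≤ (A : Submodule Rᵐᵒᵖ E))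
        (moduleSocle_le_preradical_iff hE))⟩⟩
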